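/- Let $T$ be a tree and let $G$ be a (discrete) group acting faithfully on $T$ by graph automorphisms (inversions of edges are allowed). Let $T^{(1)}$ be the barycentric subdivision of $T$, and let $\partial T$ be the boundary of $T$, i.e. the set of infinite paths without repeated vertices, two such paths being identified if they agree after deletion of a finite initial segment from each. An element of $G$ is called elliptic if it fixes a vertex of $T$ or an edge of $T$ (as an unoriented edge), and hyperbolic otherwise. Suppose that (i) the action is of general type: there are two hyperbolic elements of $G$ that have no common fixed point on $\partial T$; (ii) the action is finitely fledged: for every elliptic $g \in G \setminus \{1\}$, the smallest subtree $\Upsilon_T(g)$ of $T^{(1)}$ containing the set $\Psi_T(g)$ of all vertices of $T^{(1)}$ that are fixed by $g$ and have a neighbour in $T^{(1)}$ not fixed by $g$ has finite diameter. Then $G$ is not inner amenable, i.e. there is no finitely additive probability measure, defined on all subsets of $G \setminus \{1\}$, that is invariant under conjugation by the elements of $G$. -/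

import Mathlib

/-! ### Inner amenability -/

/-- Conjugation by `h` on the set of nontrivial elements of a group. -/
def conjNontrivial {G : Type*} [Group G] (h : G) (x : {g : G // g ≠ 1}) : {g : G // g ≠ 1} :=
  ⟨h * x.1 * h⁻¹, fun hx => x.2 (conj_eq_one_iff.mp hx)⟩

/-- A (discrete) group `G` is inner amenable if there is a conjugation invariant, positive, finitely
additive probability measure, defined on all subsets of `G ∖ {1}`. -/
def InnerAmenable (G : Type*) [Group G] : Prop :=
  ∃ m : Set {g : G // g ≠ 1} → ℝ,
    (∀ A, 0 ≤ m A) ∧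
    m Set.univ = 1 ∧
    (∀ A B, Disjoint A B → m (A ∪ B) = m A + m B) ∧
    (∀ (h : G) (A), m (conjNontrivial h '' A) = m A)

namespace TreeAction

/-! ### The barycentric subdivision -/

/-- The barycentric subdivision of a graph: its vertices are the vertices and the (geometric) edges
of `T`, and a vertex `v` of `T` is adjacent to an edge `e` of `T` when `v` is an endpoint of `e`. -/
def subdivision {V : Type*} (T : SimpleGraph V) : SimpleGraph (V ⊕ T.edgeSet) where
  Adj x y := (∃ (v : V) (e : T.edgeSet), v ∈ e.1 ∧ x = Sum.inl v ∧ y = Sum.inr e) ∨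
    (∃ (v : V) (e : T.edgeSet), v ∈ e.1 ∧ y = Sum.inl v ∧ x = Sum.inr e)
  symm := ⟨fun _ _ h => h.symm⟩
  loopless := ⟨by
    rintro x (⟨v, e, -, h₁, h₂⟩ | ⟨v, e, -, h₁, h₂⟩) <;> simp [h₁] at h₂⟩

theorem subdivision_adj_inl_inr {V : Type*} {T : SimpleGraph V} (v : V) (e : T.edgeSet) :
    (subdivision T).Adj (Sum.inl v) (Sum.inr e) ↔ v ∈ e.1 := by
  simp [subdivision]

theorem subdivision_adj_inr_inl {V : Type*} {T : SimpleGraph V} (v : V) (e : T.edgeSet) :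
    (subdivision T).Adj (Sum.inr e) (Sum.inl v) ↔ v ∈ e.1 := by
  simp [subdivision]

theorem not_subdivision_adj_inl_inl {V : Type*} {T : SimpleGraph V} (v w : V) :
    ¬ (subdivision T).Adj (Sum.inl v) (Sum.inl w) := by
  simp [subdivision]

theorem not_subdivision_adj_inr_inr {V : Type*} {T : SimpleGraph V} (e f : T.edgeSet) :
    ¬ (subdivision T).Adj (Sum.inr e) (Sum.inr f) := by
  simp [subdivision]

/-- The bijection of the vertex set of the subdivision induced by an automorphism of `T`. -/
def subdivisionEquiv {V : Type*} {T : SimpleGraph V} (φ : T ≃g T) :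
    (V ⊕ T.edgeSet) ≃ (V ⊕ T.edgeSet) :=
  Equiv.sumCongr φ.toEquiv φ.mapEdgeSet

theorem mem_mapEdgeSet_iff {V : Type*} {T : SimpleGraph V} (φ : T ≃g T) (v : V)
    (e : T.edgeSet) : φ v ∈ (φ.mapEdgeSet e).1 ↔ v ∈ e.1 := by
  change φ v ∈ Sym2.map φ e.1 ↔ v ∈ e.1
  rw [Sym2.mem_map]
  exact ⟨fun ⟨w, hw, h⟩ => φ.injective h ▸ hw, fun h => ⟨v, h, rfl⟩⟩

/-- The automorphism of the barycentric subdivision induced by an automorphism of `T`. -/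
def subdivisionIso {V : Type*} {T : SimpleGraph V} (φ : T ≃g T) :
    subdivision T ≃g subdivision T where
  toEquiv := subdivisionEquiv φ
  map_rel_iff' := by
    rintro (v | e) (w | f)
    · simp [subdivisionEquiv, not_subdivision_adj_inl_inl]
    · exact (subdivision_adj_inl_inr _ _).trans
        ((mem_mapEdgeSet_iff φ v f).trans (subdivision_adj_inl_inr _ _).symm)
    · exact (subdivision_adj_inr_inl _ _).trans
        ((mem_mapEdgeSet_iff φ w e).trans (subdivision_adj_inr_inl _ _).symm)
    · simp [subdivisionEquiv, not_subdivision_adj_inr_inr]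

/-! ### The boundary -/

/-- A ray in a graph: an infinite path `f 0, f 1, f 2, …` without repeated vertices. -/
structure Ray {V : Type*} (T : SimpleGraph V) where
  toFun : ℕ → V
  adj : ∀ n, T.Adj (toFun n) (toFun (n + 1))
  inj : Function.Injective toFun

/-- Two rays are cofinal if they coincide after deleting a finite initial segment from each. -/
def rayCofinal {V : Type*} (T : SimpleGraph V) : Setoid (Ray T) where
  r f f' := ∃ m n : ℕ, ∀ k, f.toFun (m + k) = f'.toFun (n + k)
  iseqv :=
    { refl := fun _ => ⟨0, 0, fun _ => rfl⟩
      symm := fun ⟨m, n, h⟩ => ⟨n, m, fun k => (h k).symm⟩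
      trans := by
        rintro f f' f'' ⟨m, n, h⟩ ⟨p, q, h'⟩
        refine ⟨m + p, q + n, fun k => ?_⟩
        have h₁ := h (p + k)
        have h₂ := h' (n + k)
        rw [add_assoc, add_assoc, h₁, ← h₂]
        congr 1
        omega }

/-- The boundary `∂T` of a tree: rays up to cofinality. -/
def Boundary {V : Type*} (T : SimpleGraph V) : Type _ := Quotient (rayCofinal T)

/-- The image of a ray under an automorphism. -/
def mapRay {V : Type*} {T : SimpleGraph V} (φ : T ≃g T) (f : Ray T) : Ray T where
  toFun n := φ (f.toFun n)
  adj n := φ.map_adj_iff.mpr (f.adj n)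
  inj := φ.injective.comp f.inj

/-- The action of an automorphism of `T` on the boundary. -/
def mapBoundary {V : Type*} {T : SimpleGraph V} (φ : T ≃g T) : Boundary T → Boundary T :=
  Quotient.map (sa := rayCofinal T) (sb := rayCofinal T) (mapRay φ)
    (fun _ _ ⟨m, n, h⟩ => ⟨m, n, fun k => congrArg φ (h k)⟩)

/-! ### Elliptic and hyperbolic automorphisms, actions of general type -/

/-- An automorphism is elliptic if it fixes a vertex or a geometric edge of `T` (possibly
inverting the edge). -/
def IsElliptic {V : Type*} {T : SimpleGraph V} (φ : T ≃g T) : Prop :=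
  (∃ v : V, φ v = v) ∨ (∃ e : T.edgeSet, φ.mapEdgeSet e = e)

/-- An automorphism is hyperbolic if it is not elliptic. -/
def IsHyperbolic {V : Type*} {T : SimpleGraph V} (φ : T ≃g T) : Prop := ¬ IsElliptic φ

/-- Two automorphisms are transverse if they have no common fixed point on the boundary. -/
def Transverse {V : Type*} {T : SimpleGraph V} (φ ψ : T ≃g T) : Prop :=
  ∀ ξ : Boundary T, ¬ (mapBoundary φ ξ = ξ ∧ mapBoundary ψ ξ = ξ)

/-- An action of `G` on `T`, given as a homomorphism to the automorphism group of `T`, is of general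
type if there are two transverse hyperbolic elements. -/
def IsGeneralType {G V : Type*} [Group G] {T : SimpleGraph V} (ρ : G →* (T ≃g T)) : Prop :=
  ∃ g h : G, IsHyperbolic (ρ g) ∧ IsHyperbolic (ρ h) ∧ Transverse (ρ g) (ρ h)

/-! ### Finitely fledged actions -/

/-- The set `Ψ` of the vertices of the barycentric subdivision that are fixed by the automorphism
and have a neighbour that is not fixed. -/
def fixedFrontier {V : Type*} {T : SimpleGraph V} (φ : T ≃g T) : Set (V ⊕ T.edgeSet) :=
  {t | subdivisionIso φ t = t ∧ ∃ s, (subdivision T).Adj t s ∧ subdivisionIso φ s ≠ s}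

/-- The subtree `Υ` spanned by `Ψ`: the smallest connected subgraph of the barycentric subdivision
that contains `Ψ`, obtained as the intersection of all of them. -/
def fixedFrontierSpan {V : Type*} {T : SimpleGraph V} (φ : T ≃g T) : (subdivision T).Subgraph :=
  sInf {S : (subdivision T).Subgraph | S.Connected ∧ fixedFrontier φ ⊆ S.verts}

/-- An automorphism is finitely fledged if the subtree `Υ` has finite diameter. -/
def FinitelyFledged {V : Type*} {T : SimpleGraph V} (φ : T ≃g T) : Prop :=
  (fixedFrontierSpan φ).coe.ediam ≠ ⊤

/-- An action is finitely fledged if every nontrivial elliptic element is finitely fledged. -/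
def IsFinitelyFledged {G V : Type*} [Group G] {T : SimpleGraph V} (ρ : G →* (T ≃g T)) : Prop :=
  ∀ g : G, g ≠ 1 → IsElliptic (ρ g) → FinitelyFledged (ρ g)

end TreeAction

/-! To every nontrivial `g` one attaches, equivariantly under conjugation, a nonempty vertex set
`support (ρ g)`: the axis of a hyperbolic element, or the centres of the frontier of the fixed set
of an elliptic one, which exist because finite fledging makes that frontier bounded. Any three of
its points are collinear up to an error of 2 (`nearlyCollinear_support`).

Transverse hyperbolic elements `h`, `k` have height functions `q`, `q'` on the vertices, which they
raise by positive constants. The elements whose support reaches height `i` form a family decreasing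
in `i`, and conjugation by `h` or `k` pushes it upwards; under an invariant mean all its members
have the same measure (`mean_sdiff_eq_zero`). So, outside a null set, a support that rises above
`-|R|` rises above `|R|`, simultaneously for `q`, `q'` and `-q'`. Such a support has a point where
`|q|` is large; there `q'` is small, so it also has points with `q' ≥ R` and `q' ≤ -R`. These three
lie towards different ends and span a long tripod, contradicting near collinearity
(`exists_transverse_heights`). -/

namespace TreeAction

/-! ### The metric of a tree -/

section Metric

variable {V : Type*} {T : SimpleGraph V}

/-- The graph distance, with values in the integers. -/
noncomputable def idist (T : SimpleGraph V) (x y : V) : ℤ := T.dist x y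

theorem idist_nonneg (x y : V) : 0 ≤ idist T x y := Int.natCast_nonneg _

theorem idist_self (x : V) : idist T x x = 0 := by simp [idist]

theorem idist_comm (x y : V) : idist T x y = idist T y x := by
  simp [idist, SimpleGraph.dist_comm]

theorem idist_triangle (hT : T.IsTree) (x y z : V) :
    idist T x z ≤ idist T x y + idist T y z := by
  have := hT.connected.dist_triangle (u := x) (v := y) (w := z)
  unfold idist
  exact_mod_cast this

theorem idist_eq_zero (hT : T.IsTree) {x y : V} : idist T x y = 0 ↔ x = y := by
  rw [idist, Nat.cast_eq_zero, hT.connected.dist_eq_zero_iff]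

theorem idist_eq_one {x y : V} : idist T x y = 1 ↔ T.Adj x y := by
  rw [idist, Nat.cast_eq_one, SimpleGraph.dist_eq_one_iff_adj]

theorem idist_map (φ : T ≃g T) (x y : V) : idist T (φ x) (φ y) = idist T x y := by
  have key : ∀ (ψ : T ≃g T) (x y : V), T.Reachable x y → T.dist (ψ x) (ψ y) ≤ T.dist x y := by
    intro ψ x y h
    obtain ⟨p, hp⟩ := h.exists_walk_length_eq_dist
    have := SimpleGraph.dist_le (p.map ψ.toHom)
    rw [SimpleGraph.Walk.length_map, hp] at this
    exact this
  unfold idist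
  norm_cast
  by_cases h : T.Reachable x y
  · refine le_antisymm (key φ x y h) ?_
    have := key φ.symm (φ x) (φ y) (φ.reachable_iff.mpr h)
    simpa using this
  · rw [SimpleGraph.dist_eq_zero_of_not_reachable h,
      SimpleGraph.dist_eq_zero_of_not_reachable (fun h' => h (φ.reachable_iff.mp h'))]

theorem exists_adj_idist (hT : T.IsTree) {x y : V} (h : x ≠ y) :
    ∃ u, T.Adj x u ∧ idist T u y = idist T x y - 1 := by
  obtain ⟨p, hp⟩ := hT.connected.exists_walk_length_eq_dist x y
  cases p with
  | nil => exact absurd rfl h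
  | @cons _ u _ hadj q =>
    refine ⟨u, hadj, le_antisymm ?_ ?_⟩
    · have := SimpleGraph.dist_le q
      rw [SimpleGraph.Walk.length_cons] at hp
      unfold idist
      omega
    · have := idist_triangle hT x u y
      rw [idist_eq_one.mpr hadj] at this
      omega

/-- In a tree there is only one neighbour in the direction of a given vertex. -/
theorem adj_unique (hT : T.IsTree) {x y u v : V} (hu : T.Adj x u) (hv : T.Adj x v)
    (hu' : idist T u y = idist T x y - 1) (hv' : idist T v y = idist T x y - 1) : u = v := by
  -- A neighbour closer to `y` is the second vertex of a path from `x` to `y`, and that path is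
  -- unique.
  have key : ∀ w, T.Adj x w → idist T w y = idist T x y - 1 →
      ∃ p : T.Path x y, p.1.snd = w := by
    intro w hw hw'
    obtain ⟨q, hq⟩ := hT.connected.exists_walk_length_eq_dist w y
    refine ⟨⟨q.cons hw, ?_⟩, by simp⟩
    apply SimpleGraph.Walk.isPath_of_length_eq_dist
    rw [SimpleGraph.Walk.length_cons]
    unfold idist at hw'
    omega
  obtain ⟨p, hp⟩ := key u hu hu'
  obtain ⟨q, hq⟩ := key v hv hv'
  rw [← hp, ← hq, (hT.isAcyclic.subsingleton_path _ _).elim p q]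

theorem idist_adj (hT : T.IsTree) {x u : V} (h : T.Adj x u) (y : V) :
    idist T u y = idist T x y - 1 ∨ idist T u y = idist T x y + 1 := by
  have := hT.dist_eq_dist_add_one_of_adj y h
  rw [idist_comm u, idist_comm x]
  unfold idist
  omega

/-- Geodesics that leave a vertex in different directions can be concatenated. -/
theorem idist_add_of_ne (hT : T.IsTree) {x y z u v : V} (hu : T.Adj x u) (hv : T.Adj x v)
    (hu' : idist T u y = idist T x y - 1) (hv' : idist T v z = idist T x z - 1) (huv : u ≠ v) :
    idist T y z = idist T x y + idist T x z := by
  obtain ⟨n, hn⟩ : ∃ n : ℕ, idist T x z = n := ⟨_, rfl⟩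
  induction n generalizing x u v with
  | zero => have := idist_nonneg (T := T) v z; omega
  | succ n ih =>
    -- Induction moves `x` to `v`: this approaches `z` and recedes from `y`, so `x` and the next
    -- step towards `z` are again different directions at `v`.
    have h1 : idist T v y = idist T x y + 1 :=
      (idist_adj hT hv y).resolve_left fun h => huv (adj_unique hT hu hv hu' h)
    by_cases hvz : v = z
    · subst hvz
      have := idist_self (T := T) v
      rw [idist_comm] at h1
      omega
    · obtain ⟨w, hw, hw'⟩ := exists_adj_idist hT hvz
      have := ih hv.symm hw (by omega) hw' (by rintro rfl; omega) (by push_cast at hn; omega)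
      omega

/-- The four-point condition. -/
theorem four_point (hT : T.IsTree) (x y z w : V) :
    idist T x y + idist T z w ≤
      max (idist T x z + idist T y w) (idist T x w + idist T y z) := by
  obtain ⟨n, hn⟩ : ∃ n : ℕ, idist T x y = n := ⟨_, rfl⟩
  have t1 := idist_triangle hT z x w
  rw [idist_comm z x] at t1
  induction n generalizing x with
  | zero =>
    obtain rfl := (idist_eq_zero hT).mp hn
    omega
  | succ n ih =>
    have hxy : x ≠ y := fun h => by rw [(idist_eq_zero hT).mpr h] at hn; omega
    by_cases hxz : x = z
    · subst hxz
      have := idist_self (T := T) x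
      have := idist_comm (T := T) x y
      omega
    by_cases hxw : x = w
    · subst hxw
      have := idist_self (T := T) x
      have := idist_comm (T := T) x y
      have := idist_comm (T := T) x z
      omega
    obtain ⟨a, ha, ha'⟩ := exists_adj_idist hT hxy
    obtain ⟨b, hb, hb'⟩ := exists_adj_idist hT hxz
    obtain ⟨c, hc, hc'⟩ := exists_adj_idist hT hxw
    -- If `y`, `z`, `w` lie in one direction from `x`, a step that way lowers all three distances by
    -- one. Otherwise `x` separates `y` from `z` or from `w`, and the triangle inequality `t1`
    -- suffices.
    by_cases hab : a = b
    · by_cases hac : a = c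
      · subst hab hac
        have t2 := idist_triangle hT z a w
        rw [idist_comm z a] at t2
        have := ih a (by push_cast at hn; omega) t2
        omega
      · have := idist_add_of_ne hT ha hc ha' hc' hac
        omega
    · have := idist_add_of_ne hT ha hb ha' hb' hab
      omega

theorem exists_between (hT : T.IsTree) (x y : V) (k : ℤ) (hk : 0 ≤ k) (hk' : k ≤ idist T x y) :
    ∃ z, idist T x z = k ∧ idist T z y = idist T x y - k := by
  lift k to ℕ using hk
  induction k with
  | zero => exact ⟨x, by simp [idist_self]⟩
  | succ k ih =>
    push_cast at hk' ⊢
    obtain ⟨z, hz, hz'⟩ := ih (by omega)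
    obtain ⟨u, hu, hu'⟩ := exists_adj_idist hT (x := z) (y := y) (by
      rintro rfl; rw [idist_self] at hz'; omega)
    have h1 := idist_triangle hT x z u
    have h2 := idist_triangle hT x u y
    rw [idist_eq_one.mpr hu] at h1
    exact ⟨u, by omega, by omega⟩

/-- Two vertices on a common geodesic. -/
theorem idist_of_between (hT : T.IsTree) {a b x y : V}
    (hx : idist T a x + idist T x b = idist T a b) (hy : idist T a y + idist T y b = idist T a b) :
    idist T x y = |idist T a x - idist T a y| := by
  have h1 := four_point hT x y a b
  have h2 := idist_triangle hT a x y
  have h3 := idist_triangle hT a y x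
  rw [idist_comm y x] at h3
  rw [idist_comm x a, idist_comm y a] at h1
  rw [abs_eq_max_neg]
  omega

end Metric

/-! ### Translations along a line -/

section Translation

variable {V : Type*} {T : SimpleGraph V}

/-- The vertices of minimal displacement. -/
def minSet (φ : T ≃g T) : Set V := {x | ∀ y, idist T x (φ x) ≤ idist T y (φ y)}

/-- A bi-infinite orbit along which `φ` translates by `l`. -/
structure IsOrbitLine (φ : T ≃g T) (c : ℤ → V) (l : ℤ) : Prop where
  pos : 0 < l
  idist_eq : ∀ i j, idist T (c i) (c j) = |i - j| * l
  map_eq : ∀ i, φ (c i) = c (i + 1)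

theorem IsOrbitLine.reverse {φ : T ≃g T} {c : ℤ → V} {l : ℤ} (h : IsOrbitLine φ c l) :
    IsOrbitLine φ⁻¹ (fun i => c (-i)) l where
  pos := h.pos
  idist_eq i j := by rw [h.idist_eq, ← abs_neg]; congr 2; ring
  map_eq i := by
    have : c (-i) = φ (c (-(i + 1))) := by rw [h.map_eq]; congr 1; ring
    rw [this]
    exact φ.symm_apply_apply _

theorem IsOrbitLine.idist_of_le {φ : T ≃g T} {c : ℤ → V} {l : ℤ} (h : IsOrbitLine φ c l)
    {i j : ℤ} (hij : i ≤ j) : idist T (c i) (c j) = j * l - i * l := by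
  rw [h.idist_eq, abs_sub_comm, abs_of_nonneg (by omega)]
  ring

theorem minSet_nonempty [Nonempty V] (φ : T ≃g T) : (minSet φ).Nonempty := by
  refine ⟨Function.argmin (fun x => T.dist x (φ x)), fun y => ?_⟩
  have := Function.argmin_le (fun x => T.dist x (φ x)) y
  unfold idist
  exact_mod_cast this

theorem IsHyperbolic.ne {φ : T ≃g T} (hφ : IsHyperbolic φ) (x : V) : φ x ≠ x :=
  fun h => hφ (Or.inl ⟨x, h⟩)

theorem IsHyperbolic.not_inverts {φ : T ≃g T} (hφ : IsHyperbolic φ) {x y : V} (h : T.Adj x y) :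
    ¬ (φ x = y ∧ φ y = x) := by
  rintro ⟨h1, h2⟩
  refine hφ (Or.inr ⟨⟨s(x, y), h⟩, Subtype.ext ?_⟩)
  change Sym2.map φ s(x, y) = s(x, y)
  rw [Sym2.map_mk, h1, h2, Sym2.eq_swap]

/-- If the geodesics from `φ x` back to `x` and on to `φ (φ x)` shared their first edge, then either
`φ` would invert an edge or the neighbour of `x` towards `φ x` would be displaced less than `x`. -/
theorem idist_map_map_of_mem_minSet (hT : T.IsTree) {φ : T ≃g T} (hφ : IsHyperbolic φ) {x : V}
    (hx : x ∈ minSet φ) : idist T x (φ (φ x)) = 2 * idist T x (φ x) := by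
  have h0 : φ x ≠ x := hφ.ne x
  obtain ⟨u, hu, hu'⟩ := exists_adj_idist hT h0
  obtain ⟨w, hw, hw'⟩ := exists_adj_idist hT h0.symm
  have hfw : idist T (φ w) (φ (φ x)) = idist T (φ x) (φ (φ x)) - 1 := by
    rw [idist_map, idist_map, hw']
  have hne : u ≠ φ w := by
    rintro rfl
    by_cases h1 : w = φ x
    · subst h1
      have h2 : idist T x (φ x) = 1 := idist_eq_one.mpr hw
      rw [idist_comm (φ x) x, h2] at hu'
      have h3 : φ (φ x) = x := (idist_eq_zero hT).mp (by omega)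
      exact hφ.not_inverts hw ⟨rfl, h3⟩
    · obtain ⟨v, hv, hv'⟩ := exists_adj_idist hT (Ne.symm h1)
      have h2 := hx w
      have h3 : idist T x w = 1 := idist_eq_one.mpr hw
      rw [idist_comm (φ x) x] at hu'
      -- both `w` and `φ w` lie on the geodesic from `x` to `φ x`
      have h4 := idist_of_between hT (a := x) (b := φ x) (x := w) (y := φ w)
        (by omega) (by
          rw [idist_comm x, hu', idist_comm (φ w), idist_eq_one.mpr hu]; omega)
      rw [h3, idist_comm x (φ w), hu', abs_eq_max_neg] at h4
      have h5 : 1 ≤ idist T w (φ x) := by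
        have := idist_nonneg (T := T) w (φ x)
        have := mt (idist_eq_zero hT (x := w) (y := φ x)).mp h1
        omega
      omega
  have := idist_add_of_ne hT hu (φ.map_adj_iff.mpr hw) hu' hfw hne
  rw [this, idist_map, idist_comm (φ x) x]
  ring

/-- Local geodesics are global: the four-point condition on `x` and its images under the powers `n`,
`n + 1`, `n + 2` propagates the case of two steps. -/
theorem idist_pow_of_mem_minSet (hT : T.IsTree) {φ : T ≃g T} (hφ : IsHyperbolic φ) {x : V}
    (hx : x ∈ minSet φ) (n : ℕ) : idist T x ((φ ^ n) x) = n * idist T x (φ x) := by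
  induction n using Nat.twoStepInduction with
  | zero => simp [idist_self]
  | one => simp
  | more n ih1 ih2 =>
    have e1 : (φ ^ (n + 1)) x = (φ ^ n) (φ x) := by rw [pow_succ]; rfl
    have e2 : (φ ^ (n + 2)) x = (φ ^ n) (φ (φ x)) := by rw [pow_succ, pow_succ]; rfl
    have h1 : idist T ((φ ^ n) x) ((φ ^ (n + 1)) x) = idist T x (φ x) := by
      rw [e1, idist_map]
    have h2 : idist T ((φ ^ (n + 1)) x) ((φ ^ (n + 2)) x) = idist T x (φ x) := by
      rw [e1, e2, idist_map, idist_map]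
    have h3 : idist T ((φ ^ n) x) ((φ ^ (n + 2)) x) = 2 * idist T x (φ x) := by
      rw [e2, idist_map, idist_map_map_of_mem_minSet hT hφ hx]
    have h4 := four_point hT x ((φ ^ (n + 1)) x) ((φ ^ n) x) ((φ ^ (n + 2)) x)
    have h5 := idist_triangle hT x ((φ ^ (n + 1)) x) ((φ ^ (n + 2)) x)
    rw [idist_comm ((φ ^ (n + 1)) x) ((φ ^ n) x)] at h4
    have h6 : 0 < idist T x (φ x) := by
      have := idist_nonneg (T := T) x (φ x)
      have := mt (idist_eq_zero hT (x := x) (y := φ x)).mp (hφ.ne x).symm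
      omega
    push_cast at ih1 ih2 ⊢
    rcases le_max_iff.mp h4 with h | h <;> linarith

theorem isOrbitLine_of_mem_minSet (hT : T.IsTree) {φ : T ≃g T} (hφ : IsHyperbolic φ) {x : V}
    (hx : x ∈ minSet φ) : IsOrbitLine φ (fun i => (φ ^ i) x) (idist T x (φ x)) where
  pos := by
    have := idist_nonneg (T := T) x (φ x)
    have := mt (idist_eq_zero hT (x := x) (y := φ x)).mp (hφ.ne x).symm
    omega
  idist_eq := by
    have key : ∀ i j : ℤ, i ≤ j →
        idist T ((φ ^ i) x) ((φ ^ j) x) = |i - j| * idist T x (φ x) := by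
      intro i j hij
      obtain ⟨n, rfl⟩ := Int.le.dest hij
      have : (φ ^ (i + n)) x = (φ ^ i) ((φ ^ n) x) := by rw [zpow_add, zpow_natCast]; rfl
      rw [this, idist_map, idist_pow_of_mem_minSet hT hφ hx]
      congr 1
      simp
    intro i j
    rcases le_total i j with h | h
    · exact key i j h
    · rw [idist_comm, abs_sub_comm]; exact key j i h
  map_eq i := by rw [add_comm, zpow_add, zpow_one]; rfl

/-- The distance to the points of a line is eventually affine. -/
theorem IsOrbitLine.exists_busemann (hT : T.IsTree) {φ : T ≃g T} {c : ℤ → V} {l : ℤ}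
    (h : IsOrbitLine φ c l) (x : V) :
    ∃ b n₀ : ℤ, b ≤ idist T x (c 0) ∧ ∀ n, n₀ ≤ n → idist T x (c n) = n * l + b := by
  -- The triangle inequality makes this quantity nonnegative and nonincreasing, so it is constant
  -- from a minimum on.
  let f : ℕ → ℕ := fun n => (idist T x (c n) + idist T x (c 0) - n * l).toNat
  have hf : ∀ n : ℕ, (f n : ℤ) = idist T x (c n) + idist T x (c 0) - n * l := by
    intro n
    have h1 := idist_triangle hT (c 0) x (c n)
    rw [h.idist_of_le (by omega), idist_comm (c 0)] at h1
    exact Int.toNat_of_nonneg (by omega)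
  have hanti : ∀ m n : ℕ, m ≤ n → f n ≤ f m := by
    intro m n hmn
    have h1 := idist_triangle hT x (c m) (c n)
    rw [h.idist_of_le (by omega)] at h1
    have := hf m
    have := hf n
    omega
  refine ⟨f (Function.argmin f) - idist T x (c 0), (Function.argmin f : ℕ), ?_, fun n hn => ?_⟩
  · have h1 := Function.argmin_le f 0
    have := hf 0
    push_cast at this
    omega
  · lift n to ℕ using by omega
    have h1 := Function.argmin_le f n
    have h2 := hanti _ n (by exact_mod_cast hn)
    have := hf n
    omega

/-- Twice the Gromov product. -/
noncomputable def gromov (T : SimpleGraph V) (p x y : V) : ℤ :=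
  idist T x p + idist T y p - idist T x y

theorem gromov_nonneg (hT : T.IsTree) (p x y : V) : 0 ≤ gromov T p x y := by
  have := idist_triangle hT x p y
  rw [idist_comm p y] at this
  unfold gromov
  omega

theorem gromov_le (hT : T.IsTree) (p x y : V) : gromov T p x y ≤ 2 * idist T x p := by
  have := idist_triangle hT y x p
  rw [idist_comm y x] at this
  unfold gromov
  omega

theorem gromov_comm (p x y : V) : gromov T p x y = gromov T p y x := by
  unfold gromov
  rw [idist_comm x y]
  ring

theorem gromov_le_add (hT : T.IsTree) (p q x y : V) :
    gromov T p x y ≤ gromov T q x y + 2 * idist T p q := by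
  have h1 := idist_triangle hT x q p
  have h2 := idist_triangle hT y q p
  rw [idist_comm q p] at h1 h2
  unfold gromov
  omega

/-- The four-point condition in its ultrametric form. -/
theorem min_gromov_le (hT : T.IsTree) (p x y z : V) :
    min (gromov T p x y) (gromov T p y z) ≤ gromov T p x z := by
  have h := four_point hT x z p y
  have := idist_comm (T := T) y p
  have := idist_comm (T := T) y z
  have := idist_comm (T := T) z p
  unfold gromov
  omega

theorem IsOrbitLine.gromov_neg_le (hT : T.IsTree) {φ : T ≃g T} {c : ℤ → V} {l : ℤ}
    (h : IsOrbitLine φ c l) (p : V) {m n : ℤ} (hm : m ≤ 0) (hn : 0 ≤ n) :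
    gromov T p (c m) (c n) ≤ 2 * idist T p (c 0) := by
  have h1 := gromov_le_add hT p (c 0) (c m) (c n)
  have h2 : gromov T (c 0) (c m) (c n) = 0 := by
    rw [gromov, h.idist_of_le hm, h.idist_of_le (hm.trans hn), idist_comm, h.idist_of_le hn]
    ring
  omega

/-- A height function along the axis of a translation. -/
theorem IsOrbitLine.exists_height (hT : T.IsTree) {φ : T ≃g T} {c : ℤ → V} {l : ℤ}
    (h : IsOrbitLine φ c l) (p : V) :
    ∃ q : V → ℤ, (∀ x, q (φ x) = q x + 2 * l) ∧ ∃ D, ∀ x, ∃ n₀, ∀ n, n₀ ≤ n →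
      q x ≤ gromov T p x (c n) + D ∧ -q x ≤ gromov T p x (c (-n)) + D := by
  choose b m hb0 hb using h.exists_busemann hT
  choose b' m' hb0' hb' using h.reverse.exists_busemann hT
  -- `φ` lowers the Busemann function `b` of the forward end by `l` and raises `b'` by `l`. Based at
  -- `c 0`, the doubled Gromov product with a far `c n` is `idist T x (c 0) - b x`, hence at least
  -- `b' x - b x`; changing the base point costs `2 * idist T p (c 0)`.
  refine ⟨fun x => b' x - b x, fun x => ?_, 2 * idist T p (c 0), fun x =>
    ⟨max 0 (max (m x) (m' x)), fun n hn => ?_⟩⟩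
  · have e1 : idist T (φ x) (c (max (m x) (m (φ x)) + 1)) = idist T x (c (max (m x) (m (φ x)))) := by
      rw [← h.map_eq, idist_map]
    have e2 : idist T (φ x) (c (-(max (m' x) (m' (φ x))))) =
        idist T x (c (-(max (m' x) (m' (φ x)) + 1))) := by
      rw [← idist_map φ x, h.map_eq]
      congr 2
      ring
    rw [hb _ _ (by omega), hb _ _ (by omega)] at e1
    rw [hb' _ _ (by omega), hb' _ _ (by omega)] at e2
    linarith
  · have h1 := hb x n (by omega)
    have h2 := hb' x n (by omega)
    have h3 := hb0 x
    have h4 := hb0' x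
    have h5 := gromov_le_add hT (c 0) p x (c n)
    have h6 := gromov_le_add hT (c 0) p x (c (-n))
    have h7 := h.idist_of_le (i := 0) (j := n) (by omega)
    have h8 := h.idist_of_le (i := -n) (j := 0) (by omega)
    rw [gromov, idist_comm (c n), idist_comm (c 0) p] at h5
    rw [gromov, idist_comm (c 0) p] at h6
    simp only [neg_zero] at *
    constructor <;> linarith

/-- Among any three points of the set, one is nearly between the two others. -/
def NearlyCollinear (T : SimpleGraph V) (S : Set V) : Prop :=
  ∀ x ∈ S, ∀ y ∈ S, ∀ z ∈ S, idist T x y + idist T y z ≤ idist T x z + 2 ∨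
    idist T y z + idist T z x ≤ idist T y x + 2 ∨ idist T z x + idist T x y ≤ idist T z y + 2

/-- Vertices of minimal displacement all lie on one line. Comparing `y` with `φ y` by the four-point
condition shows that its two Busemann values along the orbit of `x` sum to at most zero. -/
theorem exists_between_of_mem_minSet (hT : T.IsTree) {φ : T ≃g T} (hφ : IsHyperbolic φ) {x y : V}
    (hx : x ∈ minSet φ) (hy : y ∈ minSet φ) : ∃ n₀ : ℤ, ∀ n, n₀ ≤ n →
      idist T ((φ ^ (-n)) x) y + idist T y ((φ ^ n) x) =
        idist T ((φ ^ (-n)) x) ((φ ^ n) x) := by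
  have h := isOrbitLine_of_mem_minSet hT hφ hx
  obtain ⟨b, m, -, hb⟩ := h.exists_busemann hT y
  obtain ⟨b', m', -, hb'⟩ := h.reverse.exists_busemann hT y
  refine ⟨max 0 (max m m') + 1, fun n hn => ?_⟩
  have hl : idist T y (φ y) = idist T x (φ x) := le_antisymm (hy x) (hx y)
  have h1 : idist T (φ y) ((φ ^ n) x) = idist T y ((φ ^ (n - 1)) x) := by
    have := h.map_eq (n - 1)
    simp only [sub_add_cancel] at this
    rw [← this, idist_map]
  have h2 : idist T (φ y) ((φ ^ (-n)) x) = idist T y ((φ ^ (-(n + 1))) x) := by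
    have := h.map_eq (-(n + 1))
    rw [← idist_map φ y, this]
    congr 3
    ring
  have h3 := h.idist_of_le (i := -n) (j := n) (by omega)
  have h4 := h.pos
  rw [hb _ (by omega)] at h1
  rw [hb' _ (by omega)] at h2
  have h5 := hb n (by omega)
  have h6 := hb' n (by omega)
  have h7 := four_point hT y ((φ ^ n) x) (φ y) ((φ ^ (-n)) x)
  rw [idist_comm ((φ ^ n) x) ((φ ^ (-n)) x), idist_comm ((φ ^ n) x) (φ y)] at h7
  have h8 := idist_triangle hT ((φ ^ (-n)) x) y ((φ ^ n) x)
  rw [idist_comm _ y] at h8 ⊢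
  rcases le_max_iff.mp h7 with h9 | h9 <;> linarith

theorem nearlyCollinear_minSet (hT : T.IsTree) {φ : T ≃g T} (hφ : IsHyperbolic φ) :
    NearlyCollinear T (minSet φ) := by
  intro x hx y hy z hz
  obtain ⟨n₁, h₁⟩ := exists_between_of_mem_minSet hT hφ hx hx
  obtain ⟨n₂, h₂⟩ := exists_between_of_mem_minSet hT hφ hx hy
  obtain ⟨n₃, h₃⟩ := exists_between_of_mem_minSet hT hφ hx hz
  have h₁ := h₁ (max n₁ (max n₂ n₃)) (by omega)
  have h₂ := h₂ (max n₁ (max n₂ n₃)) (by omega)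
  have h₃ := h₃ (max n₁ (max n₂ n₃)) (by omega)
  have e1 := idist_of_between hT h₁ h₂
  have e2 := idist_of_between hT h₂ h₃
  have e3 := idist_of_between hT h₃ h₁
  rw [idist_comm y x, idist_comm x z, idist_comm z y]
  rw [abs_eq_max_neg] at e1 e2 e3
  have := idist_comm (T := T) x z
  omega

theorem map_mem_minSet_conj (φ ψ : T ≃g T) {x : V} (hx : x ∈ minSet φ) :
    ψ x ∈ minSet (ψ * φ * ψ⁻¹) := by
  intro y
  have e : ∀ z, (ψ * φ * ψ⁻¹) (ψ z) = ψ (φ z) := fun z =>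
    congrArg (fun w => ψ (φ w)) (ψ.symm_apply_apply z)
  obtain ⟨y, rfl⟩ := ψ.surjective y
  rw [e, e, idist_map, idist_map]
  exact hx y

end Translation

/-! ### Endpoints of axes -/

section Endpoints

variable {V : Type*} {T : SimpleGraph V}

theorem IsOrbitLine.exists_ray (hT : T.IsTree) {φ : T ≃g T} {c : ℤ → V} {l : ℤ}
    (h : IsOrbitLine φ c l) :
    ∃ r : Ray T, mapBoundary φ (Quotient.mk (rayCofinal T) r) = Quotient.mk (rayCofinal T) r ∧
      ∀ (i : ℕ) (n : ℤ), i ≤ n * l →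
        idist T (c 0) (r.toFun i) = i ∧ idist T (r.toFun i) (c n) = n * l - i := by
  have hl := h.pos
  have hc : ∀ n : ℤ, 0 ≤ n → idist T (c 0) (c n) = n * l := fun n hn => by
    rw [h.idist_of_le hn]; ring
  -- Since `l ≥ 1`, the point `c i` is at distance at least `i` from `c 0`.
  have hex : ∀ i : ℕ, ∃ z, idist T (c 0) z = i ∧ idist T z (c i) = i * l - i := by
    intro i
    have hi := hc i (by omega)
    rw [← hi]
    exact exists_between hT _ _ _ (by omega) (by rw [hi]; nlinarith)
  choose f hf hf' using hex
  have key : ∀ (i : ℕ) (n : ℤ), i ≤ n * l → idist T (f i) (c n) = n * l - i := by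
    intro i n hin
    have hn : 0 ≤ n := by by_contra hn; nlinarith
    have h0 := hf i
    have h1 := hf' i
    rcases le_total n i with hni | hni
    · have := idist_of_between hT (a := c 0) (b := c i) (x := f i) (y := c n)
        (by rw [h0, h1, hc _ (by omega)]; ring)
        (by rw [hc _ (by omega), hc _ (by omega), h.idist_of_le hni]; ring)
      rw [this, h0, hc _ hn, abs_sub_comm, abs_of_nonneg (by omega)]
    · have h2 := idist_triangle hT (f i) (c i) (c n)
      have h3 := idist_triangle hT (c 0) (f i) (c n)
      rw [h.idist_of_le hni] at h2
      rw [hc _ hn] at h3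
      omega
  have hdist : ∀ (i : ℕ) (z : V) (n : ℤ), i ≤ n * l → idist T (c 0) z + idist T z (c n) = n * l →
      idist T (f i) z = |i - idist T (c 0) z| := by
    intro i z n hin hz
    have hn : 0 ≤ n := by by_contra hn; nlinarith
    rw [idist_of_between hT (a := c 0) (b := c n) (by rw [hf, key i n hin, hc n hn]; ring)
      (by rw [hz, hc n hn]), hf]
  refine ⟨⟨f, fun i => ?_, fun i j hij => ?_⟩, ?_, fun i n hin => ⟨hf i, key i n hin⟩⟩
  · rw [← idist_eq_one, hdist i (f (i + 1)) (i + 1) (by nlinarith)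
      (by rw [hf, key _ _ (by push_cast; nlinarith)]; ring), hf]
    push_cast
    simp
  · have := hf i
    rw [hij, hf j] at this
    exact_mod_cast this.symm
  -- `φ` shifts the ray by `l`. Going through `c 1` bounds the distance of `φ (f k)` from `c 0`
  -- above by `l + k`, and the far point `c (l + k + 1)` bounds it below.
  · refine Quotient.sound ⟨0, l.toNat, fun k => ?_⟩
    change φ (f (0 + k)) = f (l.toNat + k)
    rw [zero_add]
    symm
    have h1 : idist T (φ (f k)) (c (l + k + 1)) = (l + k) * l - k := by
      have := h.map_eq (l + k)
      rw [← this, idist_map, key k _ (by nlinarith)]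
    have h2 : idist T (φ (f k)) (c 1) = k := by
      have := h.map_eq 0
      rw [zero_add] at this
      rw [← this, idist_map, idist_comm, hf]
    have h3 := idist_triangle hT (c 0) (c 1) (φ (f k))
    have h4 := idist_triangle hT (c 0) (φ (f k)) (c (l + k + 1))
    rw [hc _ (by omega), idist_comm (c 1), h2] at h3
    rw [hc _ (by omega), h1] at h4
    have h5 : idist T (c 0) (φ (f k)) = l + k := by linarith
    rw [← idist_eq_zero hT, hdist _ (φ (f k)) (l + k + 1)
      (by push_cast; rw [Int.toNat_of_nonneg hl.le]; nlinarith) (by rw [h5, h1]; ring), h5]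
    push_cast
    rw [Int.toNat_of_nonneg hl.le]
    simp

/-- If the products were unbounded, the rays of the two axes would merge, giving a boundary point
fixed by both automorphisms. -/
theorem gromov_bounded_of_transverse (hT : T.IsTree) {φ ψ : T ≃g T} {c c' : ℤ → V} {l l' : ℤ}
    (h : IsOrbitLine φ c l) (h' : IsOrbitLine ψ c' l') (htr : Transverse φ ψ) (p : V) :
    ∃ N, ∀ n m, 0 ≤ n → 0 ≤ m → gromov T p (c n) (c' m) ≤ N := by
  by_contra! hunb
  obtain ⟨r, hr, hrd⟩ := h.exists_ray hT
  obtain ⟨r', hr', hrd'⟩ := h'.exists_ray hT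
  have hl := h.pos
  have hl' := h'.pos
  set D := idist T (c 0) (c' 0) with hD
  have hD0 : 0 ≤ D := idist_nonneg _ _
  have hri : ∀ i : ℕ, idist T (c 0) (r.toFun i) = i := fun i => (hrd i i (by nlinarith)).1
  have hri' : ∀ i : ℕ, idist T (c' 0) (r'.toFun i) = i := fun i => (hrd' i i (by nlinarith)).1
  -- Beyond distance `D` from its origin, the first ray moves away from the origin of the second.
  have hstep : ∀ i : ℕ, D < i →
      idist T (c' 0) (r.toFun (i + 1)) = idist T (c' 0) (r.toFun i) + 1 := by
    intro i hi
    have h1 := four_point hT (c 0) (r.toFun (i + 1)) (c' 0) (r.toFun i)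
    have h2 : idist T (r.toFun (i + 1)) (r.toFun i) = 1 := idist_eq_one.mpr (r.adj i).symm
    have h3 := idist_triangle hT (c' 0) (r.toFun i) (r.toFun (i + 1))
    have h4 := hri i
    have h5 := hri (i + 1)
    have h6 := idist_nonneg (T := T) (c' 0) (r.toFun i)
    rw [idist_comm (r.toFun i), h2] at h3
    rw [idist_comm (r.toFun (i + 1)) (c' 0)] at h1
    push_cast at h5
    omega
  have hmem : ∀ i : ℕ, D < i → r.toFun i = r'.toFun (idist T (c' 0) (r.toFun i)).toNat := by
    intro i hi
    set e := idist T (c' 0) (r.toFun i) with he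
    have he0 : 0 ≤ e := idist_nonneg _ _
    -- With a product this large, `c n` is beyond `r.toFun i` and `c' m` is beyond distance `e`; the
    -- four-point condition then puts `r.toFun i` on the geodesic from `c' 0` to `c' m`.
    obtain ⟨n, m, hn, hm, hnm⟩ := hunb (2 * i + 2 * (D + e) + 2 * idist T p (c 0))
    have g0 := gromov_le_add hT p (c 0) (c n) (c' m)
    have g1 := gromov_le hT (c 0) (c n) (c' m)
    have g2 := gromov_le hT (c 0) (c' m) (c n)
    rw [gromov_comm] at g2
    have hcn : idist T (c 0) (c n) = n * l := by rw [h.idist_of_le hn]; ring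
    have hcm : idist T (c' 0) (c' m) = m * l' := by rw [h'.idist_of_le hm]; ring
    have t1 := idist_triangle hT (c 0) (c' 0) (c' m)
    rw [idist_comm _ (c 0), hcn] at g1
    rw [idist_comm _ (c 0)] at g2
    rw [hcm, ← hD] at t1
    have hin := (hrd i n (by omega)).2
    have h4 := hri i
    have f1 := four_point hT (r.toFun i) (c' m) (c 0) (c n)
    have hg : gromov T (c 0) (c n) (c' m) =
      n * l + idist T (c 0) (c' m) - idist T (c n) (c' m) := by
        rw [gromov, idist_comm _ (c 0), hcn, idist_comm _ (c 0)]
    rw [hcn, idist_comm _ (c 0), h4, hin, idist_comm (c' m) (c n), idist_comm (c' m) (c 0)] at f1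
    have f2 := four_point hT (c 0) (c' m) (c' 0) (r.toFun i)
    rw [← he, ← hD, idist_comm (c' m) (r.toFun i), h4, idist_comm (c' m) (c' 0), hcm] at f2
    have t2 := idist_triangle hT (c' 0) (r.toFun i) (c' m)
    rw [hcm, ← he] at t2
    have hfin : e + idist T (r.toFun i) (c' m) = m * l' := by omega
    obtain ⟨k1, k2⟩ := hrd' e.toNat m (by rw [Int.toNat_of_nonneg he0]; omega)
    rw [Int.toNat_of_nonneg he0] at k1 k2
    rw [← idist_eq_zero hT, idist_of_between hT (a := c' 0) (b := c' m)
      (by rw [← he, hfin, hcm]) (by rw [k1, k2, hcm]; ring), k1, ← he]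
    simp
  apply htr (Quotient.mk (rayCofinal T) r) ⟨hr, ?_⟩
  have : (Quotient.mk (rayCofinal T) r) = Quotient.mk (rayCofinal T) r' := by
    refine Quotient.sound ⟨D.toNat + 1, (idist T (c' 0) (r.toFun (D.toNat + 1))).toNat,
      fun k => ?_⟩
    rw [hmem _ (by push_cast; omega)]
    congr 1
    have h0 := idist_nonneg (T := T) (c' 0) (r.toFun (D.toNat + 1))
    have : idist T (c' 0) (r.toFun (D.toNat + 1 + k)) =
        idist T (c' 0) (r.toFun (D.toNat + 1)) + k := by
      induction k with
      | zero => simp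
      | succ k ih => rw [← add_assoc, hstep _ (by push_cast; omega), ih]; push_cast; ring
    omega
  rw [this]
  exact hr'

theorem mapBoundary_mul (φ ψ : T ≃g T) (ξ : Boundary T) :
    mapBoundary (φ * ψ) ξ = mapBoundary φ (mapBoundary ψ ξ) := by
  induction ξ using Quotient.inductionOn
  rfl

theorem mapBoundary_one (ξ : Boundary T) : mapBoundary (1 : T ≃g T) ξ = ξ := by
  induction ξ using Quotient.inductionOn
  rfl

theorem mapBoundary_inv_eq {φ : T ≃g T} {ξ : Boundary T} (h : mapBoundary φ⁻¹ ξ = ξ) :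
    mapBoundary φ ξ = ξ := by
  conv_lhs => rw [← h]
  rw [← mapBoundary_mul, mul_inv_cancel, mapBoundary_one]

theorem Transverse.symm {φ ψ : T ≃g T} (h : Transverse φ ψ) : Transverse ψ φ :=
  fun ξ hξ => h ξ hξ.symm

theorem Transverse.inv_left {φ ψ : T ≃g T} (h : Transverse φ ψ) : Transverse φ⁻¹ ψ :=
  fun ξ hξ => h ξ ⟨mapBoundary_inv_eq hξ.1, hξ.2⟩

theorem IsHyperbolic.exists_orbitLine (hT : T.IsTree) {φ : T ≃g T} (hφ : IsHyperbolic φ) :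
    ∃ c l, IsOrbitLine φ c l := by
  have := hT.connected.nonempty
  obtain ⟨x, hx⟩ := minSet_nonempty φ
  exact ⟨_, _, isOrbitLine_of_mem_minSet hT hφ hx⟩

/-- Points that lie far in the direction of two different ends. -/
theorem gromov_le_of_towards (hT : T.IsTree) {p x y a b : V} {N : ℤ}
    (hab : gromov T p a b ≤ N) (hx : N < gromov T p x a) (hy : N < gromov T p y b) :
    gromov T p x y ≤ N := by
  have h1 := min_gromov_le hT p a x b
  have h2 := min_gromov_le hT p x y b
  rw [gromov_comm] at hx
  omega

/-- Height functions along two transverse axes: a point that is high with respect to one of them is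
low with respect to the other, and no nearly collinear set meets three of the four directions. -/
theorem exists_transverse_heights (hT : T.IsTree) {φ ψ : T ≃g T} (hφ : IsHyperbolic φ)
    (hψ : IsHyperbolic ψ) (htr : Transverse φ ψ) :
    ∃ (q q' : V → ℤ) (l l' R : ℤ), 0 < l ∧ 0 < l' ∧ (∀ x, q (φ x) = q x + l) ∧
      (∀ x, q' (ψ x) = q' x + l') ∧ (∀ x, R ≤ |q x| → |q' x| < R) ∧
      ∀ S, NearlyCollinear T S → ¬ ∃ x ∈ S, ∃ y ∈ S, ∃ z ∈ S,
        R ≤ |q x| ∧ R ≤ q' y ∧ q' z ≤ -R := by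
  obtain ⟨c, l, h⟩ := hφ.exists_orbitLine hT
  obtain ⟨c', l', h'⟩ := hψ.exists_orbitLine hT
  obtain ⟨p⟩ := hT.connected.nonempty
  obtain ⟨q, hq, D, hqD⟩ := h.exists_height hT p
  obtain ⟨q', hq', D', hqD'⟩ := h'.exists_height hT p
  obtain ⟨N₁, h₁⟩ := gromov_bounded_of_transverse hT h h' htr p
  obtain ⟨N₂, h₂⟩ := gromov_bounded_of_transverse hT h.reverse h' htr.inv_left p
  obtain ⟨N₃, h₃⟩ := gromov_bounded_of_transverse hT h h'.reverse htr.symm.inv_left.symm p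
  obtain ⟨N₄, h₄⟩ := gromov_bounded_of_transverse hT h.reverse h'.reverse
    htr.inv_left.symm.inv_left.symm p
  -- The first four terms bound the products between ends of different axes, the last one the
  -- product of the two ends of the second axis.
  set N := max (max (max N₁ N₂) (max N₃ N₄)) (2 * idist T p (c' 0)) with hN
  have hN0 : 0 ≤ N := by have := idist_nonneg (T := T) p (c' 0); omega
  -- Height `R` forces a product above `3 * N + 2` with an end. Near collinearity of three points
  -- with pairwise products at most `N` would put the middle one within `N + 1` of `p`.
  have hR : ∃ R, N + 2 * N + 2 + D < R ∧ N + 2 * N + 2 + D' < R :=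
    ⟨max D D' + N + 2 * N + 3, by omega, by omega⟩
  obtain ⟨R, hRD, hRD'⟩ := hR
  have hx : ∀ x, R ≤ |q x| → ∃ n₀ : ℤ, ∀ n, n₀ ≤ n → ∃ a, 3 * N + 2 < gromov T p x a ∧
      ∀ m, 0 ≤ m → gromov T p a (c' m) ≤ N ∧ gromov T p a (c' (-m)) ≤ N := by
    intro x hx
    obtain ⟨n₀, hn₀⟩ := hqD x
    refine ⟨max n₀ 0, fun n hn => ?_⟩
    obtain ⟨k1, k2⟩ := hn₀ n (by omega)
    rcases le_abs.mp hx with hx | hx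
    · refine ⟨c n, by omega, fun m hm => ?_⟩
      have := h₁ n m (by omega) hm
      have := h₃ n m (by omega) hm
      omega
    · refine ⟨c (-n), by omega, fun m hm => ?_⟩
      have := h₂ n m (by omega) hm
      have := h₄ n m (by omega) hm
      omega
  have hpair : ∀ x y, R ≤ |q x| → R ≤ |q' y| → gromov T p x y ≤ N := by
    intro x y hxR hyR
    obtain ⟨n₀, hn₀⟩ := hx x hxR
    obtain ⟨m₀, hm₀⟩ := hqD' y
    obtain ⟨a, ha, ha'⟩ := hn₀ n₀ le_rfl
    obtain ⟨k1, k2⟩ := hm₀ (max m₀ 0) (by omega)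
    obtain ⟨j1, j2⟩ := ha' (max m₀ 0) (by omega)
    rcases le_abs.mp hyR with hy | hy
    · exact gromov_le_of_towards hT j1 (by omega) (by omega)
    · exact gromov_le_of_towards hT j2 (by omega) (by omega)
  have hfar : ∀ x, R ≤ |q x| → 3 * N + 2 < 2 * idist T x p := by
    intro x hxR
    obtain ⟨n₀, hn₀⟩ := hx x hxR
    obtain ⟨a, ha, -⟩ := hn₀ n₀ le_rfl
    exact ha.trans_le (gromov_le hT p x a)
  have hfar' : ∀ y, R ≤ |q' y| → 3 * N + 2 < 2 * idist T y p := by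
    intro y hyR
    obtain ⟨m₀, hm₀⟩ := hqD' y
    obtain ⟨k1, k2⟩ := hm₀ m₀ le_rfl
    have := gromov_le hT p y (c' m₀)
    have := gromov_le hT p y (c' (-m₀))
    rcases le_abs.mp hyR with hy | hy <;> omega
  refine ⟨q, q', 2 * l, 2 * l', R, by have := h.pos; omega, by have := h'.pos; omega, hq, hq',
    fun x hxR => ?_, ?_⟩
  · by_contra! hxR'
    have h1 := hpair x x hxR hxR'
    have h2 := hfar x hxR
    rw [gromov, idist_self] at h1
    omega
  · rintro S hS ⟨x, hxS, y, hyS, z, hzS, hxR, hyR, hzR⟩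
    have hyR' : R ≤ |q' y| := le_abs.mpr (Or.inl hyR)
    have hzR' : R ≤ |q' z| := le_abs.mpr (Or.inr (by omega))
    have hyz : gromov T p y z ≤ N := by
      obtain ⟨m₀, hm₀⟩ := hqD' y
      obtain ⟨m₁, hm₁⟩ := hqD' z
      obtain ⟨k1, -⟩ := hm₀ (max 0 (max m₀ m₁)) (by omega)
      obtain ⟨-, k2⟩ := hm₁ (max 0 (max m₀ m₁)) (by omega)
      have := h'.gromov_neg_le hT p (m := -max 0 (max m₀ m₁)) (n := max 0 (max m₀ m₁))
        (by omega) (by omega)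
      rw [gromov_comm] at this
      exact gromov_le_of_towards hT (a := c' (max 0 (max m₀ m₁)))
        (b := c' (-max 0 (max m₀ m₁))) (by omega) (by omega) (by omega)
    have hxy := hpair x y hxR hyR'
    have hxz := hpair x z hxR hzR'
    have gx := hfar x hxR
    have gy := hfar' y hyR'
    have gz := hfar' z hzR'
    have n1 := gromov_nonneg hT p x y
    have n2 := gromov_nonneg hT p x z
    have n3 := gromov_nonneg hT p y z
    unfold gromov at hyz hxy hxz n1 n2 n3
    have := hS x hxS y hyS z hzS
    rw [idist_comm y x, idist_comm z x, idist_comm z y] at this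
    omega

end Endpoints

/-! ### Centres of bounded sets and supports of automorphisms -/

section Support

variable {V : Type*} {T : SimpleGraph V}

/-- The centres of the balls of minimal radius that contain `B`. -/
def centers (T : SimpleGraph V) (B : Set V) : Set V :=
  {v | ∃ r : ℤ, (∀ x ∈ B, idist T v x ≤ r) ∧ ∀ w s, (∀ x ∈ B, idist T w x ≤ s) → r ≤ s}

theorem centers_nonempty {B : Set V} (hB : B.Nonempty)
    (hbdd : ∃ D, ∀ x ∈ B, ∀ y ∈ B, idist T x y ≤ D) : (centers T B).Nonempty := by
  obtain ⟨b, hb⟩ := hB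
  obtain ⟨D, hD⟩ := hbdd
  have hex : ∃ r : ℕ, ∃ v, ∀ x ∈ B, idist T v x ≤ r :=
    ⟨D.toNat, b, fun x hx => (hD b hb x hx).trans (Int.self_le_toNat D)⟩
  classical
  obtain ⟨v, hv⟩ := Nat.find_spec hex
  refine ⟨v, Nat.find hex, hv, fun w s hs => ?_⟩
  have hs0 : 0 ≤ s := (idist_nonneg w b).trans (hs b hb)
  lift s to ℕ using hs0
  exact_mod_cast Nat.find_min' hex ⟨w, hs⟩

/-- Were two centres at distance at least 2, one step from the first towards the second would reach
the centre of a smaller ball containing `B`. -/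
theorem idist_le_one_of_mem_centers (hT : T.IsTree) {B : Set V} {u w : V}
    (hu : u ∈ centers T B) (hw : w ∈ centers T B) : idist T u w ≤ 1 := by
  by_contra! h
  obtain ⟨r, hur, hr⟩ := hu
  obtain ⟨s, hws, hs⟩ := hw
  have hrs := hr w s hws
  have hsr := hs u r hur
  obtain ⟨m, hm, hm'⟩ := exists_between hT u w 1 (by omega) (by omega)
  have := hr m (r - 1) fun x hx => by
    have h1 := four_point hT m x u w
    have h2 := hur x hx
    have h3 := hws x hx
    have := idist_comm (T := T) m u
    have := idist_comm (T := T) x u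
    have := idist_comm (T := T) x w
    omega
  omega

/-- This case is what requires the error 2: centres are sought among the vertices of `T`, so two
adjacent ones may occur. -/
theorem nearlyCollinear_centers (hT : T.IsTree) (B : Set V) : NearlyCollinear T (centers T B) := by
  intro x hx y hy z hz
  have h1 := idist_le_one_of_mem_centers hT hx hy
  have h2 := idist_le_one_of_mem_centers hT hy hz
  have h3 := idist_nonneg (T := T) x z
  omega

theorem map_mem_centers {B B' : Set V} (ψ : T ≃g T) (h : ∀ x, ψ x ∈ B' ↔ x ∈ B) {v : V}
    (hv : v ∈ centers T B) : ψ v ∈ centers T B' := by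
  obtain ⟨r, hvr, hr⟩ := hv
  refine ⟨r, fun x hx => ?_, fun w s hs => ?_⟩
  · obtain ⟨x, rfl⟩ := ψ.surjective x
    rw [idist_map]
    exact hvr x ((h x).mp hx)
  · obtain ⟨w, rfl⟩ := ψ.surjective w
    refine hr w s fun x hx => ?_
    rw [← idist_map ψ]
    exact hs _ ((h x).mpr hx)

/-- A vertex of the subdivision is equal to `v` or an edge at `v`. -/
def IsNear (v : V) : V ⊕ T.edgeSet → Prop := Sum.elim (fun u => u = v) (fun e => v ∈ e.1)

theorem idist_le_one_of_isNear {v w : V} {s : V ⊕ T.edgeSet} (hv : IsNear v s) (hw : IsNear w s) :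
    idist T v w ≤ 1 := by
  rcases s with u | e
  · obtain rfl : u = v := hv
    obtain rfl : u = w := hw
    simp [idist_self]
  · by_cases hvw : v = w
    · simp [hvw, idist_self]
    · have he : e.1 = s(v, w) := ((Sym2.mem_and_mem_iff hvw).mp ⟨hv, hw⟩)
      have := e.2
      rw [he] at this
      exact (idist_eq_one.mpr this).le

theorem exists_isNear_of_adj {s t : V ⊕ T.edgeSet} (h : (subdivision T).Adj s t) :
    ∃ u, IsNear u s ∧ IsNear u t := by
  rcases h with ⟨u, e, hu, rfl, rfl⟩ | ⟨u, e, hu, rfl, rfl⟩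
  · exact ⟨u, rfl, hu⟩
  · exact ⟨u, hu, rfl⟩

theorem idist_le_length (hT : T.IsTree) {s t : V ⊕ T.edgeSet} (p : (subdivision T).Walk s t)
    {v w : V} (hv : IsNear v s) (hw : IsNear w t) : idist T v w ≤ p.length + 1 := by
  induction p generalizing v with
  | nil => simpa using idist_le_one_of_isNear hv hw
  | cons hadj p ih =>
    obtain ⟨u, hu, hu'⟩ := exists_isNear_of_adj hadj
    have h1 := ih hu' hw
    have h2 := idist_le_one_of_isNear hv hu
    have h3 := idist_triangle hT v u w
    rw [SimpleGraph.Walk.length_cons]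
    push_cast
    omega

theorem subdivisionIso_mul (φ ψ : T ≃g T) (s : V ⊕ T.edgeSet) :
    subdivisionIso (φ * ψ) s = subdivisionIso φ (subdivisionIso ψ s) := by
  rcases s with v | ⟨e, he⟩
  · rfl
  · refine congrArg Sum.inr (Subtype.ext ?_)
    induction e using Sym2.ind
    rfl

theorem map_mem_fixedFrontier {φ : T ≃g T} (ψ : T ≃g T) {s : V ⊕ T.edgeSet}
    (hs : s ∈ fixedFrontier φ) : subdivisionIso ψ s ∈ fixedFrontier (ψ * φ * ψ⁻¹) := by
  obtain ⟨h, t, hst, ht⟩ := hs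
  have e : ∀ u, subdivisionIso (ψ * φ * ψ⁻¹) (subdivisionIso ψ u) =
      subdivisionIso ψ (subdivisionIso φ u) := fun u => by
    rw [← subdivisionIso_mul, ← subdivisionIso_mul, inv_mul_cancel_right]
  refine ⟨by rw [e, h], subdivisionIso ψ t, (subdivisionIso ψ).map_adj_iff.mpr hst, ?_⟩
  rw [e]
  exact fun h' => ht ((subdivisionIso ψ).injective h')

/-- The vertices of the tree that are near the frontier of the fixed point set. -/
def frontierVerts (φ : T ≃g T) : Set V := {v | ∃ s ∈ fixedFrontier φ, IsNear v s}

theorem map_mem_frontierVerts {φ : T ≃g T} (ψ : T ≃g T) {v : V} (hv : v ∈ frontierVerts φ) :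
    ψ v ∈ frontierVerts (ψ * φ * ψ⁻¹) := by
  obtain ⟨s, hs, hvs⟩ := hv
  refine ⟨_, map_mem_fixedFrontier ψ hs, ?_⟩
  rcases s with u | e
  · exact congrArg ψ hvs
  · exact (mem_mapEdgeSet_iff ψ v e).mpr hvs

theorem map_mem_frontierVerts_iff {φ : T ≃g T} (ψ : T ≃g T) (v : V) :
    ψ v ∈ frontierVerts (ψ * φ * ψ⁻¹) ↔ v ∈ frontierVerts φ := by
  refine ⟨fun h => ?_, map_mem_frontierVerts ψ⟩
  have := map_mem_frontierVerts ψ⁻¹ h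
  rwa [show ψ⁻¹ * (ψ * φ * ψ⁻¹) * ψ⁻¹⁻¹ = φ by group,
    show ψ⁻¹ (ψ v) = v from ψ.symm_apply_apply v] at this

theorem FinitelyFledged.bounded (hT : T.IsTree) {φ : T ≃g T} (h : FinitelyFledged φ) :
    ∃ D, ∀ x ∈ frontierVerts φ, ∀ y ∈ frontierVerts φ, idist T x y ≤ D := by
  obtain ⟨n, hn⟩ := ENat.ne_top_iff_exists.mp h
  refine ⟨n + 1, ?_⟩
  rintro x ⟨s, hs, hx⟩ y ⟨t, ht, hy⟩
  have hmem : ∀ u ∈ fixedFrontier φ, u ∈ (fixedFrontierSpan φ).verts := by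
    intro u hu
    rw [fixedFrontierSpan, SimpleGraph.Subgraph.verts_sInf]
    exact Set.mem_iInter₂.mpr fun S hS => hS.2 hu
  have hle : (fixedFrontierSpan φ).coe.edist ⟨s, hmem s hs⟩ ⟨t, hmem t ht⟩ ≤ n :=
    SimpleGraph.edist_le_ediam.trans hn.ge
  obtain ⟨p, hp⟩ := SimpleGraph.exists_walk_of_edist_ne_top
    (ne_top_of_le_ne_top (ENat.natCast_ne_top n) hle)
  rw [← hp, Nat.cast_le] at hle
  have := idist_le_length hT (p.map (fixedFrontierSpan φ).hom) hx hy
  rw [SimpleGraph.Walk.length_map] at this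
  omega

/-- With empty frontier, the fixed set in the subdivision would be closed under adjacency, and
connectedness would force `φ = 1`. -/
theorem frontierVerts_nonempty (hT : T.IsTree) {φ : T ≃g T} (hφ : IsElliptic φ) (h1 : φ ≠ 1) :
    (frontierVerts φ).Nonempty := by
  suffices h : (fixedFrontier φ).Nonempty by
    obtain ⟨s, hs⟩ := h
    rcases s with v | ⟨e, he⟩
    · exact ⟨v, _, hs, rfl⟩
    · induction e using Sym2.ind with
      | _ a b => exact ⟨a, _, hs, Sym2.mem_mk_left a b⟩
  by_contra hemp
  have hfix : ∀ s t, subdivisionIso φ s = s → (subdivision T).Adj s t →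
      subdivisionIso φ t = t := by
    intro s t hs hst
    by_contra ht
    exact hemp ⟨s, hs, t, hst, ht⟩
  have hedge : ∀ (e : T.edgeSet) (v : V), subdivisionIso φ (Sum.inr e) = Sum.inr e → v ∈ e.1 →
      φ v = v := fun e v he hv =>
    Sum.inl_injective (hfix _ (Sum.inl v) he ((subdivision_adj_inr_inl v e).mpr hv))
  have hstep : ∀ u v, T.Walk u v → φ u = u → φ v = v := by
    intro u v p
    induction p with
    | nil => exact id
    | @cons a b _ hadj p ih =>
      intro hu
      refine ih (hedge ⟨s(a, b), hadj⟩ b (hfix (Sum.inl a) _ (congrArg Sum.inl hu) ?_)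
        (Sym2.mem_mk_right a b))
      exact (subdivision_adj_inl_inr _ _).mpr (Sym2.mem_mk_left a b)
  obtain ⟨v, hv⟩ : ∃ v, φ v = v := by
    rcases hφ with h | ⟨⟨e, he⟩, h⟩
    · exact h
    · induction e using Sym2.ind with
      | _ a b => exact ⟨a, hedge ⟨s(a, b), he⟩ a (congrArg Sum.inr h) (Sym2.mem_mk_left a b)⟩
  refine h1 (RelIso.ext fun w => ?_)
  obtain ⟨p⟩ := hT.connected v w
  exact hstep v w p hv

theorem IsElliptic.conj {φ : T ≃g T} (h : IsElliptic φ) (ψ : T ≃g T) :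
    IsElliptic (ψ * φ * ψ⁻¹) := by
  rcases h with ⟨v, hv⟩ | ⟨e, he⟩
  · exact Or.inl ⟨ψ v, (congrArg (fun w => ψ (φ w)) (ψ.symm_apply_apply v)).trans
      (congrArg ψ hv)⟩
  · refine Or.inr ⟨ψ.mapEdgeSet e, Sum.inr_injective (β := T.edgeSet) (α := V) ?_⟩
    change subdivisionIso (ψ * φ * ψ⁻¹) (subdivisionIso ψ (Sum.inr e)) =
      subdivisionIso ψ (Sum.inr e)
    rw [← subdivisionIso_mul, inv_mul_cancel_right, subdivisionIso_mul]
    exact congrArg (subdivisionIso ψ) (congrArg Sum.inr he)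

theorem isElliptic_conj_iff {φ : T ≃g T} (ψ : T ≃g T) :
    IsElliptic (ψ * φ * ψ⁻¹) ↔ IsElliptic φ := by
  refine ⟨fun h => ?_, fun h => h.conj ψ⟩
  have := h.conj ψ⁻¹
  rwa [show ψ⁻¹ * (ψ * φ * ψ⁻¹) * ψ⁻¹⁻¹ = φ by group] at this

open Classical in
/-- A set of vertices attached equivariantly to an automorphism: the centres of the frontier of the
fixed point set for an elliptic one, the axis for a hyperbolic one. -/
noncomputable def support (φ : T ≃g T) : Set V :=
  if IsElliptic φ then centers T (frontierVerts φ) else minSet φ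

theorem map_mem_support {φ : T ≃g T} (ψ : T ≃g T) {v : V} (hv : v ∈ support φ) :
    ψ v ∈ support (ψ * φ * ψ⁻¹) := by
  unfold support at *
  by_cases h : IsElliptic φ
  · rw [if_pos h] at hv
    rw [if_pos (h.conj ψ)]
    exact map_mem_centers ψ (map_mem_frontierVerts_iff ψ) hv
  · rw [if_neg h] at hv
    rw [if_neg (mt (isElliptic_conj_iff ψ).mp h)]
    exact map_mem_minSet_conj φ ψ hv

theorem nearlyCollinear_support (hT : T.IsTree) (φ : T ≃g T) : NearlyCollinear T (support φ) := by
  unfold support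
  split_ifs with h
  · exact nearlyCollinear_centers hT _
  · exact nearlyCollinear_minSet hT h

theorem support_nonempty (hT : T.IsTree) {φ : T ≃g T} (h1 : φ ≠ 1)
    (hf : IsElliptic φ → FinitelyFledged φ) : (support φ).Nonempty := by
  have := hT.connected.nonempty
  unfold support
  split_ifs with h
  · exact centers_nonempty (frontierVerts_nonempty hT h h1) ((hf h).bounded hT)
  · exact minSet_nonempty φ

end Support

/-! ### Finitely additive measures -/

section Mean

variable {X : Type*} {m : Set X → ℝ}

theorem mean_mono (h0 : ∀ A, 0 ≤ m A) (hadd : ∀ A B, Disjoint A B → m (A ∪ B) = m A + m B)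
    {A B : Set X} (h : A ⊆ B) : m A ≤ m B := by
  have := hadd A (B \ A) Set.disjoint_sdiff_right
  rw [Set.union_sdiff_cancel h] at this
  linarith [h0 (B \ A)]

theorem mean_union_le (h0 : ∀ A, 0 ≤ m A) (hadd : ∀ A B, Disjoint A B → m (A ∪ B) = m A + m B)
    (A B : Set X) : m (A ∪ B) ≤ m A + m B := by
  have := hadd A (B \ A) Set.disjoint_sdiff_right
  rw [Set.union_sdiff_self] at this
  linarith [mean_mono h0 hadd (Set.sdiff_subset : B \ A ⊆ B)]

/-- A decreasing family of sets that is shifted by a measure preserving map has constant measure. -/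
theorem mean_sdiff_eq_zero (h0 : ∀ A, 0 ≤ m A)
    (hadd : ∀ A B, Disjoint A B → m (A ∪ B) = m A + m B) {f : X → X}
    (hf : ∀ A, m (f '' A) = m A) {U : ℤ → Set X} (hU : Antitone U) {l : ℤ} (hl : 0 < l)
    (hfU : ∀ i, f '' U i ⊆ U (i + l)) {i j : ℤ} (hij : i ≤ j) : m (U i \ U j) = 0 := by
  have key : ∀ n : ℕ, m (U i) ≤ m (U (i + n * l)) := by
    intro n
    induction n with
    | zero => simp
    | succ n ih =>
      refine ih.trans ?_
      rw [← hf (U (i + n * l))]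
      refine mean_mono h0 hadd ((hfU _).trans_eq ?_)
      congr 1
      push_cast
      ring
  have h1 := hadd (U j) (U i \ U j) Set.disjoint_sdiff_right
  rw [Set.union_sdiff_cancel (hU hij)] at h1
  -- As `l ≥ 1`, `j - i` shifts are enough to pass from `i` beyond `j`.
  have h2 : m (U (i + (j - i).toNat * l)) ≤ m (U j) := by
    refine mean_mono h0 hadd (hU ?_)
    rw [Int.toNat_of_nonneg (by omega)]
    nlinarith
  linarith [key (j - i).toNat, h0 (U i \ U j)]

end Mean

end TreeAction

/-! ### The contradiction with an invariant mean -/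

open TreeAction in
theorem mainTheorem5 {G V : Type*} [Group G] (T : SimpleGraph V) (hT : T.IsTree)
    (ρ : G →* (T ≃g T)) (hfaithful : Function.Injective ρ)
    (hgeneral : TreeAction.IsGeneralType ρ) (hfledged : TreeAction.IsFinitelyFledged ρ) :
    ¬ InnerAmenable G := by
  rintro ⟨m, h0, huniv, hadd, hinv⟩
  obtain ⟨h, k, hh, hk, htr⟩ := hgeneral
  obtain ⟨q, q', l, l', R, hl, hl', hq, hq', hlow, hcol⟩ := exists_transverse_heights hT hh hk htr
  have hq'' : ∀ x, -q' ((ρ k)⁻¹ x) = -q' x + l' := fun x => by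
    have := hq' ((ρ k)⁻¹ x)
    rw [show ρ k ((ρ k)⁻¹ x) = x from (ρ k).apply_symm_apply x] at this
    omega
  let U : (V → ℤ) → ℤ → Set {g : G // g ≠ 1} := fun f i => {g | ∃ x ∈ support (ρ g.1), i ≤ f x}
  have hnull : ∀ (f : V → ℤ) (a : G) (d : ℤ), 0 < d → (∀ x, f (ρ a x) = f x + d) →
      ∀ i j, i ≤ j → m (U f i \ U f j) = 0 := by
    intro f a d hd hf i j hij
    refine mean_sdiff_eq_zero h0 hadd (hinv a) (U := U f) ?_ hd ?_ hij
    · rintro i j hij g ⟨x, hx, hxj⟩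
      exact ⟨x, hx, hij.trans hxj⟩
    · rintro i _ ⟨g, ⟨x, hx, hxi⟩, rfl⟩
      refine ⟨ρ a x, ?_, by rw [hf]; omega⟩
      have := map_mem_support (ρ a) hx
      rwa [← map_inv, ← map_mul, ← map_mul] at this
  -- The absolute value makes the interval nonempty, as the sign of `R` is not recorded.
  have z1 := hnull q h l hl hq (-|R|) |R| (by have := abs_nonneg R; omega)
  have z2 := hnull q' k l' hl' hq' (-|R|) |R| (by have := abs_nonneg R; omega)
  have z3 := hnull (fun x => -q' x) k⁻¹ l' hl' (by rw [map_inv]; exact hq'')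
    (-|R|) |R| (by have := abs_nonneg R; omega)
  set N := (U q (-|R|) \ U q |R|) ∪ ((U q' (-|R|) \ U q' |R|) ∪
    (U (fun x => -q' x) (-|R|) \ U (fun x => -q' x) |R|)) with hN
  have hN0 : m N ≤ 0 := by
    have h1 := mean_union_le h0 hadd (U q' (-|R|) \ U q' |R|)
      (U (fun x => -q' x) (-|R|) \ U (fun x => -q' x) |R|)
    have h2 := mean_union_le h0 hadd (U q (-|R|) \ U q |R|) ((U q' (-|R|) \ U q' |R|) ∪
      (U (fun x => -q' x) (-|R|) \ U (fun x => -q' x) |R|))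
    linarith
  obtain ⟨g, hg⟩ : ∃ g, g ∉ N := by
    by_contra! hall
    rw [Set.eq_univ_of_forall hall, huniv] at hN0
    linarith
  have hgq : ∀ {f : V → ℤ}, g ∉ U f (-|R|) \ U f |R| → ∀ x ∈ support (ρ g.1), -|R| ≤ f x →
      ∃ y ∈ support (ρ g.1), |R| ≤ f y := by
    intro f hgf x hx hfx
    by_contra hy
    exact hgf ⟨⟨x, hx, hfx⟩, hy⟩
  have hg1 := hgq fun h => hg (Or.inl h)
  have hg2 := hgq fun h => hg (Or.inr (Or.inl h))
  have hg3 := hgq fun h => hg (Or.inr (Or.inr h))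
  have hRR := le_abs_self R
  have hρ : ρ g.1 ≠ 1 := fun h => g.2 (hfaithful (h.trans (map_one ρ).symm))
  obtain ⟨x, hx⟩ := support_nonempty hT hρ (hfledged g.1 g.2)
  -- A point with `|q x| < R` is above height `-|R|`, so the support also reaches `|R|`.
  obtain ⟨x, hx, hxR⟩ : ∃ x ∈ support (ρ g.1), R ≤ |q x| := by
    by_cases hxR : R ≤ |q x|
    · exact ⟨x, hx, hxR⟩
    · obtain ⟨y, hy, hyR⟩ := hg1 x hx (by have := neg_abs_le (q x); omega)
      exact ⟨y, hy, (hRR.trans hyR).trans (le_abs_self _)⟩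
  have hx' := abs_lt.mp (hlow x hxR)
  obtain ⟨y, hy, hyR⟩ := hg2 x hx (by omega)
  obtain ⟨z, hz, hzR⟩ := hg3 x hx (by omega)
  exact hcol _ (nearlyCollinear_support hT _) ⟨x, hx, y, hy, z, hz, hxR, by omega, by omega⟩
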